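/- For a finite group $G$, the cyclic subgroups of $G$ (including the trivial subgroup) are counted as subgroups of $G$, and groups are counted up to isomorphism. Let $\mathscr{B}$ be the set of positive integers $n$ such that there are, up to isomorphism, only finitely many finite noncyclic groups having precisely $n$ cyclic subgroups. Then $$\mathscr{B} = \{1,4,6,9\} \cup \{p : p \text{ is a prime number}\}.$$ In particular, for every integer $n \geqslant 10$, the number $n$ is prime if and only if there are, up to isomorphism, only finitely many finite noncyclic groups having precisely $n$ cyclic subgroups. -/

import Mathlib

universe u

/-- The number `c(G)` of cyclic subgroups of a group `G`
(the trivial subgroup is counted). -/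
noncomputable def cyclicSubgroupCount (G : Type*) [Group G] : ℕ :=
  Nat.card {H : Subgroup G // IsCyclic H}

/-- The isomorphism relation on finite groups. -/
def finiteGroupIsoSetoid : Setoid FiniteGrp.{u} where
  r G H := Nonempty (G ≃* H)
  iseqv :=
    { refl := fun G => ⟨MulEquiv.refl G⟩
      symm := fun ⟨e⟩ => ⟨e.symm⟩
      trans := fun ⟨e⟩ ⟨f⟩ => ⟨e.trans f⟩ }

/-- The set of isomorphism classes of finite noncyclic groups that have
precisely `n` cyclic subgroups. -/
def noncyclicIsoClasses (n : ℕ) : Set (Quotient finiteGroupIsoSetoid.{u}) :=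
  Quotient.mk finiteGroupIsoSetoid.{u} ''
    {G : FiniteGrp.{u} | ¬ IsCyclic G ∧ cyclicSubgroupCount G = n}

/-- The set of positive integers `n` such that, up to isomorphism, there are only finitely
many finite noncyclic groups with precisely `n` cyclic subgroups. -/
def setB : Set ℕ :=
  {n | 0 < n ∧ (noncyclicIsoClasses.{u} n).Finite}

/-! Write c(G) for the number of cyclic subgroups. The finiteness criterion is that n is not a
product `a * b` with `2 ≤ a` and `4 ≤ b`; `forall_ne_mul_iff` identifies such n. If n = ab, pick a
noncyclic q-group H with c(H) = b. Since c is multiplicative over coprime orders, the products of H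
with cyclic groups of order r ^ (a - 1), for primes r > q, give infinitely many classes
(`infinite_noncyclicIsoClasses`). Conversely, if a prime q > c(G) divides the order of a noncyclic
G, its Sylow q-subgroup P is a cyclic direct factor, G = P × K with K noncyclic, so c(G) = c(P) c(K)
has the excluded form (`exists_cyclicSubgroupCount_eq_mul_of_lt_prime`). Otherwise all primes
dividing the order are at most n, and the order is bounded (`card_le_of_forall_prime_le`). -/

section CyclicSubgroupCount

/-! ### Counting cyclic subgroups -/

variable {G H : Type*} [Group G] [Group H]

/-- A cyclic subgroup of order `d` of a finite group has `φ d` generators. -/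
theorem card_filter_zpowers_eq [Fintype G] (C : Subgroup G) [IsCyclic C]
    [DecidablePred fun g : G => Subgroup.zpowers g = C] :
    (Finset.univ.filter fun g : G => Subgroup.zpowers g = C).card = (Nat.card C).totient := by
  classical
  have : Fintype C := Fintype.ofFinite C
  rw [← IsCyclic.card_orderOf_eq_totient (α := C) (d := Nat.card C) (by simp)]
  symm
  refine Finset.card_bij (fun x _ => (x : G)) ?_ (fun _ _ _ _ h => Subtype.ext h) ?_
  · intro x hx
    simp only [Finset.mem_filter, Finset.mem_univ, true_and] at hx ⊢
    apply Subgroup.eq_of_le_of_card_ge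
    · simp
    · rw [Nat.card_zpowers, Subgroup.orderOf_coe, hx]
  · intro g hg
    simp only [Finset.mem_filter, Finset.mem_univ, true_and] at hg
    refine ⟨⟨g, hg ▸ Subgroup.mem_zpowers g⟩, ?_, rfl⟩
    simp only [Finset.mem_filter, Finset.mem_univ, true_and]
    rw [Subgroup.orderOf_mk, ← hg, Nat.card_zpowers]

/-- The number of cyclic subgroups as a sum over the elements of the group. -/
theorem cyclicSubgroupCount_eq_sum [Fintype G] :
    (cyclicSubgroupCount G : ℚ) = ∑ g : G, ((orderOf g).totient : ℚ)⁻¹ := by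
  classical
  have : Fintype {C : Subgroup G // IsCyclic C} := Fintype.ofFinite _
  -- The fibre of `f` over C is the set of generators of C, so its weights sum to 1.
  let f : G → {C : Subgroup G // IsCyclic C} := fun g => ⟨Subgroup.zpowers g, inferInstance⟩
  rw [← Finset.sum_fiberwise Finset.univ f, cyclicSubgroupCount, Nat.card_eq_fintype_card,
    ← Finset.card_univ, Finset.card_eq_sum_ones, Nat.cast_sum]
  refine Finset.sum_congr rfl fun C _ => ?_
  have := C.2
  have h : ∀ g ∈ Finset.univ.filter (fun g => f g = C),
      ((orderOf g).totient : ℚ)⁻¹ = ((Nat.card C.1).totient : ℚ)⁻¹ := by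
    intro g hg
    simp only [Finset.mem_filter, Finset.mem_univ, true_and] at hg
    rw [← hg, ← Nat.card_zpowers]
  rw [Finset.sum_congr rfl h, Finset.sum_const]
  have h2 : (Finset.univ.filter fun g => f g = C) =
      Finset.univ.filter fun g : G => Subgroup.zpowers g = C.1 := by
    ext g; simp [f, Subtype.ext_iff]
  rw [h2, card_filter_zpowers_eq, nsmul_eq_mul, mul_inv_cancel₀, Nat.cast_one]
  exact_mod_cast (Nat.totient_pos.2 Nat.card_pos).ne'

theorem cyclicSubgroupCount_le_of_injective [Finite H] (f : G →* H) (hf : Function.Injective f) :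
    cyclicSubgroupCount G ≤ cyclicSubgroupCount H := by
  refine Nat.card_le_card_of_injective
    (fun C : {C : Subgroup G // IsCyclic C} =>
      (⟨C.1.map f,
        have := C.2; isCyclic_of_surjective _ (f.subgroupMap_surjective C.1)⟩ : {C : Subgroup H // IsCyclic C})) ?_
  intro C D h
  exact Subtype.ext (Subgroup.map_injective hf (Subtype.ext_iff.1 h))

theorem cyclicSubgroupCount_congr [Finite H] (e : G ≃* H) :
    cyclicSubgroupCount G = cyclicSubgroupCount H := by
  have : Finite G := Finite.of_equiv H e.symm.toEquiv
  exact le_antisymm (cyclicSubgroupCount_le_of_injective e.toMonoidHom e.injective)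
    (cyclicSubgroupCount_le_of_injective e.symm.toMonoidHom e.symm.injective)

theorem cyclicSubgroupCount_of_isCyclic [Finite G] [IsCyclic G] :
    cyclicSubgroupCount G = (Nat.card G).divisors.card := by
  classical
  have : Fintype G := Fintype.ofFinite G
  have hmem : ∀ g ∈ (Finset.univ : Finset G), orderOf g ∈ (Nat.card G).divisors := fun g _ =>
    Nat.mem_divisors.2 ⟨orderOf_dvd_natCard g, Nat.card_pos.ne'⟩
  have h : (cyclicSubgroupCount G : ℚ) = ((Nat.card G).divisors.card : ℚ) := by
    rw [cyclicSubgroupCount_eq_sum, ← Finset.sum_fiberwise_of_maps_to hmem, Finset.card_eq_sum_ones,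
      Nat.cast_sum]
    refine Finset.sum_congr rfl fun d hd => ?_
    have h : ∀ g ∈ Finset.univ.filter (fun g : G => orderOf g = d),
        ((orderOf g).totient : ℚ)⁻¹ = (d.totient : ℚ)⁻¹ := by
      intro g hg
      rw [(Finset.mem_filter.1 hg).2]
    rw [Finset.sum_congr rfl h, Finset.sum_const, IsCyclic.card_orderOf_eq_totient, nsmul_eq_mul,
      mul_inv_cancel₀, Nat.cast_one]
    · exact_mod_cast (Nat.totient_pos.2 (Nat.pos_of_mem_divisors hd)).ne'
    · simpa using Nat.dvd_of_mem_divisors hd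
  exact_mod_cast h

/-- Coprime orders multiply in a product and φ is multiplicative, so the sum over elements factors.
-/
theorem cyclicSubgroupCount_prod_of_coprime [Finite G] [Finite H]
    (h : (Nat.card G).Coprime (Nat.card H)) :
    cyclicSubgroupCount (G × H) = cyclicSubgroupCount G * cyclicSubgroupCount H := by
  have : Fintype G := Fintype.ofFinite G
  have : Fintype H := Fintype.ofFinite H
  have key : (cyclicSubgroupCount (G × H) : ℚ) =
      cyclicSubgroupCount G * cyclicSubgroupCount H := by
    rw [cyclicSubgroupCount_eq_sum, cyclicSubgroupCount_eq_sum, cyclicSubgroupCount_eq_sum,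
      Finset.sum_mul_sum, Fintype.sum_prod_type]
    refine Finset.sum_congr rfl fun a _ => Finset.sum_congr rfl fun b _ => ?_
    have hab : (orderOf a).Coprime (orderOf b) :=
      Nat.Coprime.of_dvd (orderOf_dvd_natCard a) (orderOf_dvd_natCard b) h
    rw [Prod.orderOf, hab.lcm_eq_mul, Nat.totient_mul hab, Nat.cast_mul, mul_inv]
  exact_mod_cast key

/-- A noncyclic finite group `A × B`, where the order of `A` is a prime `q` and `B` is cyclic of
order `q ^ k`, has exactly `2 + q * k` cyclic subgroups. -/
theorem cyclicSubgroupCount_prod_of_prime {q k : ℕ} (hq : q.Prime) [IsCyclic G] [IsCyclic H]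
    (hG : Nat.card G = q) (hH : Nat.card H = q ^ k) :
    cyclicSubgroupCount (G × H) = 2 + q * k := by
  classical
  have : Finite G := Nat.finite_of_card_ne_zero (hG ▸ hq.ne_zero)
  have : Finite H := Nat.finite_of_card_ne_zero (hH ▸ pow_ne_zero _ hq.ne_zero)
  have : Fintype G := Fintype.ofFinite G
  have : Fintype H := Fintype.ofFinite H
  have hcG : (cyclicSubgroupCount G : ℚ) = 2 := by
    rw [cyclicSubgroupCount_of_isCyclic, hG, hq.divisors, Finset.card_pair hq.one_lt.ne]; rfl
  have hcH : (cyclicSubgroupCount H : ℚ) = k + 1 := by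
    rw [cyclicSubgroupCount_of_isCyclic, hH, Nat.divisors_prime_pow hq]; simp
  have key : (cyclicSubgroupCount (G × H) : ℚ) = 2 + q * k := by
    rw [cyclicSubgroupCount_eq_sum] at hcG hcH ⊢
    rw [Fintype.sum_prod_type_right, ← Finset.add_sum_erase _ _ (Finset.mem_univ (1 : H))]
    rw [← Finset.add_sum_erase _ _ (Finset.mem_univ (1 : H))] at hcH
    -- For b ≠ 1, q divides the order of b, so b alone determines the order of (a, b). The terms
    -- with b = 1 contribute c(G) = 2, the others q (c(H) - 1) = q k.
    have h1 : ∀ b ∈ Finset.univ.erase (1 : H),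
        ∑ a : G, ((orderOf (a, b)).totient : ℚ)⁻¹ = q * ((orderOf b).totient : ℚ)⁻¹ := by
      intro b hb
      obtain ⟨i, -, hi⟩ := (Nat.dvd_prime_pow hq).1 (hH ▸ orderOf_dvd_natCard b)
      have hi0 : i ≠ 0 := by
        rintro rfl
        exact (Finset.mem_erase.1 hb).1 (orderOf_eq_one_iff.1 (by simpa using hi))
      have h2 : ∀ a : G, orderOf (a, b) = orderOf b := fun a => by
        rw [Prod.orderOf]
        refine Nat.lcm_eq_right ?_
        exact (hG ▸ orderOf_dvd_natCard a).trans (hi ▸ dvd_pow_self q hi0)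
      simp only [h2, Finset.sum_const, Finset.card_univ, ← Nat.card_eq_fintype_card, hG,
        nsmul_eq_mul]
    rw [Finset.sum_congr rfl h1, ← Finset.mul_sum]
    simp only [Prod.orderOf, orderOf_one, Nat.lcm_one_right, Nat.totient_one, Nat.cast_one,
      inv_one] at hcG hcH ⊢
    rw [hcG, show ∑ b ∈ Finset.univ.erase (1 : H), ((orderOf b).totient : ℚ)⁻¹ = k by linarith]
  exact_mod_cast key

/-- Each term of the sum over elements is at least 1 / m, because φ(d) ≤ d. -/
theorem card_le_cyclicSubgroupCount_mul [Finite G] {m : ℕ} (hm : ∀ g : G, orderOf g ≤ m) :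
    Nat.card G ≤ cyclicSubgroupCount G * m := by
  have : Fintype G := Fintype.ofFinite G
  have key : (Nat.card G : ℚ) ≤ cyclicSubgroupCount G * m := by
    rw [cyclicSubgroupCount_eq_sum, Finset.sum_mul, Nat.card_eq_fintype_card, ← Finset.card_univ,
      Finset.card_eq_sum_ones, Nat.cast_sum]
    refine Finset.sum_le_sum fun g _ => ?_
    have h0 : (0 : ℚ) < (orderOf g).totient := by
      exact_mod_cast Nat.totient_pos.2 (orderOf_pos g)
    rw [Nat.cast_one, inv_mul_eq_div, le_div_iff₀ h0, one_mul]
    exact_mod_cast (Nat.totient_le _).trans (hm g)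
  exact_mod_cast key

theorem card_divisors_orderOf_le_cyclicSubgroupCount [Finite G] (g : G) :
    (orderOf g).divisors.card ≤ cyclicSubgroupCount G := by
  rw [← Nat.card_zpowers, ← cyclicSubgroupCount_of_isCyclic]
  exact cyclicSubgroupCount_le_of_injective (Subgroup.zpowers g).subtype
    (Subgroup.subtype_injective _)

theorem two_le_cyclicSubgroupCount [Finite G] [Nontrivial G] : 2 ≤ cyclicSubgroupCount G := by
  obtain ⟨g, hg⟩ := exists_ne (1 : G)
  refine le_trans ?_ (card_divisors_orderOf_le_cyclicSubgroupCount g)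
  have h : ({1, orderOf g} : Finset ℕ) ⊆ (orderOf g).divisors := by
    intro d hd
    rw [Finset.mem_insert, Finset.mem_singleton] at hd
    rcases hd with rfl | rfl <;> simp [(orderOf_pos g).ne']
  rw [← Finset.card_pair (fun h => hg (orderOf_eq_one_iff.1 h.symm))]
  exact Finset.card_le_card h

/-- A noncyclic finite group has at least four cyclic subgroups. -/
theorem four_le_cyclicSubgroupCount [Finite G] (hG : ¬ IsCyclic G) :
    4 ≤ cyclicSubgroupCount G := by
  obtain ⟨g, hg⟩ := Finite.exists_max (fun g : G => orderOf g)
  have hne : Subgroup.zpowers g ≠ ⊤ := fun h => hG ((isCyclic_iff_exists_zpowers_eq_top).2 ⟨g, h⟩)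
  obtain ⟨h, hh⟩ : ∃ h, h ∉ Subgroup.zpowers g := by
    by_contra! hall
    exact hne (eq_top_iff.2 fun x _ => hall x)
  -- Maximality of the order of `g` is used here; then 1, g, h, gh generate four distinct subgroups.
  have hgh : g ∉ Subgroup.zpowers h := by
    intro hmem
    have hle : Subgroup.zpowers g ≤ Subgroup.zpowers h := by simpa using hmem
    have heq := Subgroup.eq_of_le_of_card_ge hle (by simpa [Nat.card_zpowers] using hg h)
    exact hh (heq ▸ Subgroup.mem_zpowers h)
  have h1 : g * h ∉ Subgroup.zpowers g := fun hm =>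
    hh ((Subgroup.mul_mem_cancel_left _ (Subgroup.mem_zpowers g)).1 hm)
  have h2 : g * h ∉ Subgroup.zpowers h := fun hm =>
    hgh ((Subgroup.mul_mem_cancel_right _ (Subgroup.mem_zpowers h)).1 hm)
  let z : G → {C : Subgroup G // IsCyclic C} := fun x => ⟨Subgroup.zpowers x, inferInstance⟩
  have hz : ∀ x y, x ∉ Subgroup.zpowers y → z x ≠ z y := fun x y hxy heq =>
    hxy ((Subgroup.ext_iff.1 (Subtype.ext_iff.1 heq) x).1 (Subgroup.mem_zpowers x))
  have hone : ∀ x y : G, x ∉ Subgroup.zpowers y → x ∉ Subgroup.zpowers (1 : G) := fun x y hxy hx =>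
    hxy (by simp only [Subgroup.zpowers_one_eq_bot, Subgroup.mem_bot] at hx; simp [hx])
  classical
  have : Fintype {C : Subgroup G // IsCyclic C} := Fintype.ofFinite _
  have hcard : ({z (g * h), z h, z g, z 1} : Finset _).card = 4 := by
    rw [Finset.card_insert_of_notMem, Finset.card_insert_of_notMem, Finset.card_pair]
    · exact hz _ _ (hone _ _ hgh)
    · simp only [Finset.mem_insert, Finset.mem_singleton, not_or]
      exact ⟨hz _ _ hh, hz _ _ (hone _ _ hh)⟩
    · simp only [Finset.mem_insert, Finset.mem_singleton, not_or]
      exact ⟨hz _ _ h2, hz _ _ h1, hz _ _ (hone _ _ h1)⟩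
  rw [cyclicSubgroupCount, Nat.card_eq_fintype_card, ← hcard]
  exact Finset.card_le_univ _

end CyclicSubgroupCount

/-! ### Primes exceeding the number of cyclic subgroups -/

section LargePrime

open scoped Pointwise

variable {G : Type*} [Group G] [Finite G]

/-- A finite `q`-group with fewer than `q` cyclic subgroups is cyclic. -/
theorem IsPGroup.isCyclic_of_cyclicSubgroupCount_lt {q : ℕ} [Fact q.Prime] (hG : IsPGroup q G)
    (hlt : cyclicSubgroupCount G < q) : IsCyclic G := by
  by_contra hcyc
  have hq : q.Prime := Fact.out
  obtain ⟨j, hj⟩ := IsPGroup.iff_card.1 hG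
  have hj0 : j ≠ 0 := by
    rintro rfl
    have := (Nat.card_eq_one_iff_unique.1 (by simpa using hj)).1
    exact hcyc inferInstance
  obtain ⟨i, rfl⟩ := Nat.exists_eq_succ_of_ne_zero hj0
  have horder : ∀ g : G, orderOf g ≤ q ^ i := by
    intro g
    obtain ⟨l, hl, hgl⟩ := (Nat.dvd_prime_pow hq).1 (hj ▸ orderOf_dvd_natCard g)
    have hli : l ≠ i + 1 := by
      rintro rfl
      exact hcyc (isCyclic_of_orderOf_eq_card g (hgl.trans hj.symm))
    rw [hgl]
    exact Nat.pow_le_pow_right hq.pos (by omega)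
  -- This reads q ^ (i + 1) ≤ c(G) q ^ i, against c(G) < q.
  have h := card_le_cyclicSubgroupCount_mul horder
  rw [hj, pow_succ, mul_comm] at h
  exact absurd (Nat.le_of_mul_le_mul_right h (pow_pos hq.pos i)) (by omega)

/-- If `q` exceeds the number of cyclic subgroups, then every `q`-subgroup normalizes every cyclic
subgroup. -/
theorem conj_mem_zpowers_of_cyclicSubgroupCount_lt {q : ℕ} [Fact q.Prime]
    (hlt : cyclicSubgroupCount G < q) {P : Subgroup G} (hP : IsPGroup q P) {g : G} (hg : g ∈ P)
    (x : G) : g * x * g⁻¹ ∈ Subgroup.zpowers x := by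
  have hq : q.Prime := Fact.out
  let A : Subgroup (MulAut G) := P.map MulAut.conj
  have hA : IsPGroup q A := hP.map _
  have hcyc : ∀ C ∈ MulAction.orbit A (Subgroup.zpowers x), IsCyclic C := by
    rintro _ ⟨a, rfl⟩
    have : IsCyclic (Subgroup.zpowers x) := inferInstance
    exact isCyclic_of_surjective _
      ((MulDistribMulAction.toMonoidEnd (MulAut G) G (a : MulAut G)).subgroupMap_surjective
        (Subgroup.zpowers x))
  -- The conjugation orbit of ⟨x⟩ under P has q-power size and consists of fewer than q cyclic
  -- subgroups, so it is a point.
  obtain ⟨n, hn⟩ := hA.card_orbit (Subgroup.zpowers x)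
  have hle : q ^ n ≤ cyclicSubgroupCount G := by
    rw [← hn]
    exact Nat.card_le_card_of_injective
      (fun C : MulAction.orbit A (Subgroup.zpowers x) =>
        (⟨C.1, hcyc C.1 C.2⟩ : {C : Subgroup G // IsCyclic C}))
      fun C D h => Subtype.ext (congrArg (fun C => C.1) h)
  have hn0 : n = 0 := by
    by_contra hn0
    exact absurd (hle.trans_lt hlt) (not_lt.2 (Nat.le_self_pow hn0 q))
  rw [hn0, pow_zero] at hn
  have hsub := (Nat.card_eq_one_iff_unique.1 hn).1
  let a : A := ⟨MulAut.conj g, Subgroup.mem_map_of_mem _ hg⟩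
  have hfix : a • Subgroup.zpowers x = Subgroup.zpowers x :=
    Subtype.ext_iff.1 (hsub.elim ⟨_, MulAction.mem_orbit _ a⟩ ⟨_, MulAction.mem_orbit_self _⟩)
  rw [← hfix]
  exact Subgroup.smul_mem_pointwise_smul x a _ (Subgroup.mem_zpowers x)

/-- A prime divisor `q` of the order of a noncyclic finite group `G` that exceeds the number of
cyclic subgroups splits off a cyclic direct factor; so the number of cyclic subgroups factors. -/
theorem exists_cyclicSubgroupCount_eq_mul_of_lt_prime {q : ℕ} (hq : q.Prime)
    (hlt : cyclicSubgroupCount G < q) (hdvd : q ∣ Nat.card G) (hG : ¬ IsCyclic G) :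
    ∃ a b, 2 ≤ a ∧ 4 ≤ b ∧ cyclicSubgroupCount G = a * b := by
  have : Fact q.Prime := ⟨hq⟩
  have hcyc : ∀ P : Sylow q G, IsCyclic P := fun P =>
    P.2.isCyclic_of_cyclicSubgroupCount_lt
      ((cyclicSubgroupCount_le_of_injective _ (Subgroup.subtype_injective _)).trans_lt hlt)
  have hle : Nat.card (Sylow q G) ≤ cyclicSubgroupCount G :=
    Nat.card_le_card_of_injective
      (fun P : Sylow q G => (⟨P, hcyc P⟩ : {C : Subgroup G // IsCyclic C}))
      fun P Q h => Sylow.ext (Subtype.ext_iff.1 h)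
  have hone : Nat.card (Sylow q G) = 1 :=
    Nat.ModEq.eq_of_lt_of_lt (card_sylow_modEq_one q G) (hle.trans_lt hlt) hq.one_lt
  have : Subsingleton (Sylow q G) := (Nat.card_eq_one_iff_unique.1 hone).1
  obtain ⟨P⟩ : Nonempty (Sylow q G) := inferInstance
  have hnorm : (P : Subgroup G).Normal := P.normal_of_subsingleton
  obtain ⟨K, hK⟩ := Subgroup.exists_right_complement'_of_coprime P.card_coprime_index
  have hcop : (Nat.card P).Coprime (Nat.card K) := hK.symm.index_eq_card ▸ P.card_coprime_index
  -- The commutator lies in P by normality and in ⟨x⟩ ≤ K because P normalizes ⟨x⟩; P and K meet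
  -- trivially.
  have hcomm : ∀ (g : P) (x : K), Commute (g : G) (x : G) := by
    intro g x
    have h1 : (g : G) * x * (g : G)⁻¹ * (x : G)⁻¹ ∈ Subgroup.zpowers (x : G) :=
      mul_mem (conj_mem_zpowers_of_cyclicSubgroupCount_lt hlt P.2 g.2 x)
        (inv_mem (Subgroup.mem_zpowers _))
    have h2 : (g : G) * x * (g : G)⁻¹ * (x : G)⁻¹ ∈ (P : Subgroup G) := by
      rw [mul_assoc, mul_assoc, ← mul_assoc (x : G)]
      exact mul_mem g.2 (hnorm.conj_mem _ (inv_mem g.2) _)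
    have h3 : Subgroup.zpowers (x : G) ≤ K := by simp
    have h4 := Subgroup.disjoint_def.1 hK.disjoint h2 (h3 h1)
    exact mul_inv_eq_iff_eq_mul.1 (mul_inv_eq_one.1 h4)
  let f : P × K →* G := MonoidHom.noncommCoprod (P : Subgroup G).subtype K.subtype hcomm
  have hf : Function.Bijective f := by
    rw [Nat.bijective_iff_injective_and_card, Nat.card_prod]
    refine ⟨(MonoidHom.noncommCoprod_injective _ _ hcomm).2 ⟨Subgroup.subtype_injective _,
      Subgroup.subtype_injective _, ?_⟩, hK.card_mul_card⟩
    simpa using hK.disjoint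
  let e : P × K ≃* G := MulEquiv.ofBijective f hf
  have hnt : Nontrivial P := (Subgroup.nontrivial_iff_ne_bot _).2 (P.ne_bot_of_dvd_card hdvd)
  refine ⟨cyclicSubgroupCount P, cyclicSubgroupCount K, two_le_cyclicSubgroupCount,
    four_le_cyclicSubgroupCount fun hKc => hG ?_, ?_⟩
  · have := Group.isCyclic_prod_iff.2 ⟨hcyc P, hKc, hcop⟩
    exact isCyclic_of_surjective e e.surjective
  · rw [← cyclicSubgroupCount_prod_of_coprime hcop, cyclicSubgroupCount_congr e]

/-- The order of a finite group is bounded in terms of the number of cyclic subgroups and a bound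
for the prime divisors of the order. -/
theorem card_le_of_forall_prime_le {n : ℕ} (hn : cyclicSubgroupCount G = n)
    (hp : ∀ q : ℕ, q.Prime → q ∣ Nat.card G → q ≤ n) :
    Nat.card G ≤ n * n.factorial ^ n := by
  rw [← hn]
  refine card_le_cyclicSubgroupCount_mul fun g => ?_
  rw [hn]
  -- The order of `g` divides (n!) ^ n: its primes divide n!, and an exponent e yields e + 1
  -- divisors, hence e + 1 cyclic subgroups, so e < n.
  refine Nat.le_of_dvd (pow_pos n.factorial_pos n) ?_
  rw [← Nat.factorization_prime_le_iff_dvd (orderOf_pos g).ne'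
    (pow_pos n.factorial_pos n).ne']
  intro q hq
  by_cases hqg : q ∣ orderOf g
  · have hqn : q ∣ n.factorial :=
      (hq.dvd_factorial).2 (hp q hq (hqg.trans (orderOf_dvd_natCard g)))
    have h1 : 1 ≤ n.factorial.factorization q :=
      (hq.dvd_iff_one_le_factorization n.factorial_pos.ne').1 hqn
    have h2 : (orderOf g).factorization q + 1 ≤ n := by
      rw [← hn]
      refine le_trans ?_ (card_divisors_orderOf_le_cyclicSubgroupCount g)
      have h3 : (q ^ (orderOf g).factorization q).divisors ⊆ (orderOf g).divisors :=
        Nat.divisors_subset_of_dvd (orderOf_pos g).ne' (Nat.ordProj_dvd _ _)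
      simpa [Nat.divisors_prime_pow hq] using Finset.card_le_card h3
    rw [Nat.factorization_pow, Finsupp.smul_apply, smul_eq_mul]
    nlinarith
  · rw [Nat.factorization_eq_zero_of_not_dvd hqg]
    exact Nat.zero_le _

end LargePrime

/-! ### Finiteness and infinitude of the isomorphism classes -/

section IsoClasses

theorem Group.finite_structures (α : Type*) [Finite α] : Finite (Group α) := by
  refine Finite.of_injective (fun g : Group α => g.mul) fun g h hgh => Group.ext ?_
  funext a b
  exact congr_fun (congr_fun hgh a) b

theorem finite_isoClasses_of_card_le (m : ℕ) :
    (Quotient.mk finiteGroupIsoSetoid.{u} ''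
      {G : FiniteGrp.{u} | Nat.card G ≤ m}).Finite := by
  have : ∀ k : ℕ, Finite (Group (ULift.{u} (Fin k))) := fun k => Group.finite_structures _
  let F : (Σ k : Fin (m + 1), Group (ULift.{u} (Fin k))) → Quotient finiteGroupIsoSetoid.{u} :=
    fun s => letI := s.2; Quotient.mk _ (FiniteGrp.of (ULift.{u} (Fin s.1)))
  refine (Set.finite_range F).subset ?_
  rintro _ ⟨G, hG, rfl⟩
  let e : ULift.{u} (Fin (Nat.card G)) ≃ G := Equiv.ulift.trans (Finite.equivFin G).symm
  refine ⟨⟨⟨Nat.card G, Nat.lt_succ_of_le hG⟩, e.group⟩, Quotient.sound ?_⟩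
  let := e.group
  exact ⟨e.mulEquiv⟩

theorem finite_noncyclicIsoClasses {n : ℕ} (hn : ∀ a b, 2 ≤ a → 4 ≤ b → n ≠ a * b) :
    (noncyclicIsoClasses.{u} n).Finite := by
  refine (finite_isoClasses_of_card_le (n * n.factorial ^ n)).subset (Set.image_mono ?_)
  rintro G ⟨hG, hc⟩
  refine card_le_of_forall_prime_le hc fun q hq hdvd => ?_
  by_contra! hlt
  obtain ⟨a, b, ha, hb, hab⟩ :=
    exists_cyclicSubgroupCount_eq_mul_of_lt_prime hq (hc.trans_lt hlt) hdvd hG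
  exact hn a b ha hb (hc.symm.trans hab)

/-- For each `b ≥ 4` there is a noncyclic finite group, of prime power order, with exactly `b`
cyclic subgroups; its products with cyclic groups of coprime order `r ^ (a - 1)` have `a * b`. -/
theorem infinite_noncyclicIsoClasses {a b : ℕ} (ha : 2 ≤ a) (hb : 4 ≤ b) :
    (noncyclicIsoClasses.{u} (a * b)).Infinite := by
  -- Writing b - 2 = q k makes the count 2 + q k of `H` equal to b.
  obtain ⟨q, hq, k, hk⟩ := Nat.exists_prime_and_dvd (show b - 2 ≠ 1 by omega)
  have hk0 : k ≠ 0 := by rintro rfl; omega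
  let H := Multiplicative (ZMod q) × Multiplicative (ZMod (q ^ k))
  -- For prime r, the exponent a - 1 gives exactly a divisors.
  let C : ℕ → Type := fun r => Multiplicative (ZMod (r ^ (a - 1)))
  have hcardZ : ∀ m, Nat.card (Multiplicative (ZMod m)) = m := fun m =>
    (Nat.card_congr Multiplicative.toAdd).trans (Nat.card_zmod m)
  have hcardH : Nat.card H = q ^ (k + 1) := by
    rw [Nat.card_prod, hcardZ, hcardZ, pow_succ, mul_comm]
  have hcardC : ∀ r, Nat.card (C r) = r ^ (a - 1) := fun r => hcardZ _
  let S := {r : ℕ // r.Prime ∧ q < r}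
  have hS : Infinite S := by
    refine Set.infinite_coe_iff.2 (Set.infinite_of_not_bddAbove ?_)
    rintro ⟨m, hm⟩
    obtain ⟨r, hr, hrp⟩ := Nat.exists_infinite_primes (m + q + 1)
    have := hm (a := r) ⟨hrp, by omega⟩
    omega
  have hfinH : Finite H := Nat.finite_of_card_ne_zero (hcardH ▸ pow_ne_zero _ hq.ne_zero)
  have hfinC : ∀ r : S, Finite (C r) := fun r =>
    Nat.finite_of_card_ne_zero (hcardC r ▸ pow_ne_zero _ r.2.1.ne_zero)
  let X : S → FiniteGrp.{u} := fun r => FiniteGrp.of (ULift.{u} (C r × H))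
  have e : ∀ r, Nonempty (X r ≃* C r × H) := fun r => ⟨MulEquiv.ulift⟩
  have hcardX : ∀ r : S, Nat.card (X r) = (r : ℕ) ^ (a - 1) * q ^ (k + 1) := fun r => by
    rw [Nat.card_congr (e r).some.toEquiv, Nat.card_prod, hcardC, hcardH]
  have hcyc : ¬ IsCyclic H := by
    intro h
    have := (Group.isCyclic_prod_iff.1 h).2.2
    rw [hcardZ, hcardZ, Nat.coprime_pow_right_iff (Nat.pos_of_ne_zero hk0), Nat.coprime_self] at this
    exact hq.one_lt.ne' this
  have hcH : cyclicSubgroupCount H = b := by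
    rw [cyclicSubgroupCount_prod_of_prime hq (hcardZ _) (hcardZ _)]
    omega
  refine Set.infinite_of_injective_forall_mem (f := fun r => Quotient.mk _ (X r)) ?_ ?_
  · intro r s hrs
    obtain ⟨f⟩ : Nonempty (X r ≃* X s) := Quotient.exact hrs
    have h := Nat.card_congr f.toEquiv
    rw [hcardX, hcardX] at h
    have h' := Nat.eq_of_mul_eq_mul_right (pow_pos hq.pos _) h
    exact Subtype.ext (Nat.pow_left_injective (n := a - 1) (by omega) h')
  · intro r
    refine ⟨X r, ⟨fun h => hcyc ?_, ?_⟩, rfl⟩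
    · exact isCyclic_of_surjective ((MonoidHom.snd (C r) H).comp (e r).some.toMonoidHom)
        (Prod.snd_surjective.comp (e r).some.surjective)
    · have hcop : (Nat.card (C r)).Coprime (Nat.card H) := by
        rw [hcardC, hcardH]
        exact Nat.Coprime.pow _ _ ((Nat.coprime_primes r.2.1 hq).2 r.2.2.ne')
      have hcC : cyclicSubgroupCount (C r) = a := by
        have : IsCyclic (C r) := inferInstanceAs (IsCyclic (Multiplicative _))
        rw [cyclicSubgroupCount_of_isCyclic, hcardC, Nat.divisors_prime_pow r.2.1]
        simp only [Finset.card_map, Finset.card_range]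
        omega
      have := hfinC r
      rw [cyclicSubgroupCount_congr (e r).some, cyclicSubgroupCount_prod_of_coprime hcop, hcC, hcH]

end IsoClasses

/-- A positive number is a prime or one of `1`, `4`, `6`, `9` if and only if it has no proper
divisor greater than `3`. -/
theorem forall_ne_mul_iff {n : ℕ} (hn : 0 < n) :
    (∀ a b, 2 ≤ a → 4 ≤ b → n ≠ a * b) ↔ n = 1 ∨ n = 4 ∨ n = 6 ∨ n = 9 ∨ n.Prime := by
  constructor
  · intro h
    by_contra! hcon
    obtain ⟨h1, h4, h6, h9, hp⟩ := hcon
    have hmin := (Nat.minFac_prime h1).two_le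
    obtain ⟨b, hb⟩ := Nat.minFac_dvd n
    have hsq : n.minFac ^ 2 ≤ n := Nat.minFac_sq_le_self hn hp
    have hb4 : b < 4 := by
      by_contra! hb4
      exact h _ _ hmin hb4 hb
    -- With minFac n = p this leaves 2 ≤ p ≤ b ≤ 3, that is n = 4, 6 or 9.
    have hle : n.minFac ≤ b := by nlinarith
    generalize n.minFac = p at *
    interval_cases b <;> interval_cases p <;> omega
  · rintro (rfl | rfl | rfl | rfl | hp) a b ha hb hab
    · nlinarith
    · nlinarith
    · nlinarith
    · have h1 : a ≤ 2 := by nlinarith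
      have h2 : b ≤ 4 := by nlinarith
      interval_cases a; interval_cases b; omega
    · exact Nat.not_prime_mul (by omega) (by omega) (hab ▸ hp)

theorem finite_noncyclicIsoClasses_iff {n : ℕ} (hn : 0 < n) :
    (noncyclicIsoClasses.{u} n).Finite ↔ n = 1 ∨ n = 4 ∨ n = 6 ∨ n = 9 ∨ n.Prime := by
  rw [← forall_ne_mul_iff hn]
  refine ⟨fun h a b ha hb hab => ?_, finite_noncyclicIsoClasses⟩
  subst hab
  exact infinite_noncyclicIsoClasses ha hb h

theorem theorem1p5 :
    setB.{u} = {1, 4, 6, 9} ∪ {p : ℕ | Nat.Prime p} ∧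
      ∀ n : ℕ, 10 ≤ n → (Nat.Prime n ↔ (noncyclicIsoClasses.{u} n).Finite) := by
  constructor
  · ext n
    simp only [setB, Set.mem_ofPred_eq, Set.mem_union, Set.mem_insert_iff, Set.mem_singleton_iff,
      or_assoc]
    constructor
    · rintro ⟨hn, h⟩
      exact (finite_noncyclicIsoClasses_iff hn).1 h
    · intro h
      have hn : 0 < n := by
        rcases h with rfl | rfl | rfl | rfl | hp
        iterate 4 norm_num
        exact hp.pos
      exact ⟨hn, (finite_noncyclicIsoClasses_iff hn).2 h⟩
  · intro n hn
    rw [finite_noncyclicIsoClasses_iff (by omega)]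
    constructor
    · tauto
    · rintro (rfl | rfl | rfl | rfl | hp)
      iterate 4 omega
      exact hp
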